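/- Let $d\ge 1$. Let $D=D([0,\infty),\mathbb{R}^d)$ be the space of càdlàg paths with the usual (local) Skorokhod $J_1$ topology: $x_n\to x$ iff there are increasing bijections $\lambda_n$ of $[0,\infty)$ with $\sup_{t\ge 0}|\lambda_n(t)-t|\to 0$ and $\sup_{t\le T}\|x_n(\lambda_n(t))-x(t)\|\to 0$ for every $T>0$. Let $\mathcal{H}=C([0,\infty)\times\mathbb{R}^d,\mathbb{R})$ with the topology of uniform convergence on compact sets, and give $D\times\mathcal{H}$ the product topology and its Borel $\sigma$-algebra. For $(x,\Phi)\in D\times\mathcal{H}$ put $y(t)=\Phi(t,x(t))$ and $$\tau(x,\Phi)=\inf\{t\ge 0:\ y(t)\ge 0\}\in[0,\infty],\qquad \inf\varnothing=\infty .$$ Say that $(x,\Phi)$ satisfies NT if either (i) $\tau(x,\Phi)=\infty$ and $\sup_{0\le s\le T}y(s)<0$ for every $T>0$; or (ii) $\tau(x,\Phi)<\infty$, $\sup_{0\le s\le T}y(s)<0$ for every $0\le T<\tau(x,\Phi)$, and $\sup_{s\in[\tau(x,\Phi),\,\tau(x,\Phi)+\varepsilon]}y(s)>0$ for every $\varepsilon>0$.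 **Theorem 3.2** (Weak convergence via the continuous mapping theorem). Let $(X_n,\Phi_n)$, $n\in\mathbb{N}$, and $(X,\Phi)$ be random elements of $D\times\mathcal{H}$, possibly defined on different probability spaces; no independence between path and barrier is assumed. If $(X_n,\Phi_n)\Rightarrow(X,\Phi)$ in $D\times\mathcal{H}$ and $(X,\Phi)$ satisfies NT almost surely, then $\tau(X_n,\Phi_n)$ and $\tau(X,\Phi)$ are random variables (measurable with respect to the completed probability spaces) and $$\tau(X_n,\Phi_n)\Rightarrow\tau(X,\Phi)\qquad\text{in }[0,\infty].$$ -/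

import Mathlib

open MeasureTheory ProbabilityTheory Filter Topology Set
open scoped NNReal ENNReal Uniformity

/-- The space `D([0,∞), ℝ^d)` of càdlàg paths: right-continuous functions with left limits.
(At `t = 0` the left-limit clause is void.) -/
structure CadlagPath (d : ℕ) where
  toFun : ℝ≥0 → EuclideanSpace ℝ (Fin d)
  right_cts : ∀ t, ContinuousWithinAt toFun (Ici t) t
  left_lim : ∀ t, ∃ l, Tendsto toFun (𝓝[<] t) (𝓝 l)

namespace CadlagPath

variable {d : ℕ}

instance : CoeFun (CadlagPath d) (fun _ => ℝ≥0 → EuclideanSpace ℝ (Fin d)) := ⟨toFun⟩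

/-- The pairs `(x, y)` for which some time change `γ` (an increasing bijection of `[0,∞)`) moves
every time by at most `ε` and satisfies `‖x (γ t) - y t‖ ≤ ε` for all `t ≤ T`. -/
def entourage (d : ℕ) (T : ℝ≥0) (ε : ℝ) : Set (CadlagPath d × CadlagPath d) :=
  {p | ∃ γ : ℝ≥0 ≃o ℝ≥0, (∀ t, dist (γ t) t ≤ ε) ∧ ∀ t ≤ T, dist (p.1 (γ t)) (p.2 t) ≤ ε}

theorem entourage_mono {T S : ℝ≥0} {ε δ : ℝ} (h : S ≤ T) (h' : ε ≤ δ) :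
    entourage d T ε ⊆ entourage d S δ := fun _ ⟨γ, h1, h2⟩ =>
  ⟨γ, fun t => (h1 t).trans h', fun t ht => (h2 t (ht.trans h)).trans h'⟩

theorem le_of_dist_le_one {s t T : ℝ≥0} (h : dist s t ≤ 1) (ht : t ≤ T) : s ≤ T + 1 := by
  rw [NNReal.dist_eq] at h
  have := (abs_le.1 h).2
  have ht' : (t : ℝ) ≤ T := ht
  apply NNReal.coe_le_coe.1
  push_cast
  linarith

/-- The entourages `entourage d T ε`, `ε > 0`, as a filter basis. -/
def entourageBasis (d : ℕ) : FilterBasis (CadlagPath d × CadlagPath d) where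
  sets := {V | ∃ T : ℝ≥0, ∃ ε : ℝ, 0 < ε ∧ V = entourage d T ε}
  nonempty := ⟨_, 0, 1, one_pos, rfl⟩
  inter_sets := by
    rintro _ _ ⟨T, ε, hε, rfl⟩ ⟨S, δ, hδ, rfl⟩
    exact ⟨_, ⟨max T S, min ε δ, lt_min hε hδ, rfl⟩, subset_inter
      (entourage_mono (le_max_left _ _) (min_le_left _ _))
      (entourage_mono (le_max_right _ _) (min_le_right _ _))⟩

/-- The uniform structure of `D([0,∞), ℝ^d)` whose topology is the usual (local) Skorokhod `J₁`
topology: `xₙ → x` iff there are time changes `γₙ` of `[0,∞)` with `sup_t |γₙ t - t| → 0` and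
`sup_{t ≤ T} ‖xₙ (γₙ t) - x t‖ → 0` for every `T`. -/
instance : UniformSpace (CadlagPath d) := .ofCore <| .mkOfBasis (entourageBasis d)
  (by
    rintro _ ⟨T, ε, hε, rfl⟩ x
    exact ⟨OrderIso.refl _, fun t => by simpa using hε.le, fun t _ => by simpa using hε.le⟩)
  (by
    rintro _ ⟨T, ε, hε, rfl⟩
    refine ⟨_, ⟨T + 1, min ε 1, lt_min hε one_pos, rfl⟩, ?_⟩
    rintro ⟨x, y⟩ ⟨γ, h1, h2⟩
    have h3 : ∀ t, dist (γ.symm t) t ≤ min ε 1 := fun t => by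
      simpa [dist_comm] using h1 (γ.symm t)
    refine ⟨γ.symm, fun t => (h3 t).trans (min_le_left _ _), fun t ht => ?_⟩
    have := h2 (γ.symm t) (le_of_dist_le_one ((h3 t).trans (min_le_right _ _)) ht)
    rw [dist_comm]
    simpa using this.trans (min_le_left _ _))
  (by
    rintro _ ⟨T, ε, hε, rfl⟩
    refine ⟨_, ⟨T + 1, min (ε / 2) 1, lt_min (half_pos hε) one_pos, rfl⟩, ?_⟩
    rintro ⟨x, z⟩ ⟨y, ⟨γ, h1, h2⟩, ⟨η, h3, h4⟩⟩
    have hl : min (ε / 2) 1 ≤ ε / 2 := min_le_left _ _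
    refine ⟨η.trans γ, fun t => ?_, fun t ht => ?_⟩
    · have := dist_triangle (γ (η t)) (η t) t
      simp only [OrderIso.trans_apply]
      linarith [h1 (η t), h3 t]
    · have a := h2 (η t) (le_of_dist_le_one ((h3 t).trans (min_le_right _ _)) ht)
      have b := h4 t (ht.trans le_self_add)
      have := dist_triangle (x (γ (η t))) (y (η t)) (z t)
      simp only [OrderIso.trans_apply]
      linarith)

end CadlagPath

/-- The space `ℋ = C([0,∞) × ℝ^d, ℝ)` of barriers; its topology is the compact-open one, that is,
uniform convergence on space-time compacts. -/
abbrev Barrier (d : ℕ) := C(ℝ≥0 × EuclideanSpace ℝ (Fin d), ℝ)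

/-- The product space `D([0,∞), ℝ^d) × ℋ`, with the product topology and its Borel `σ`-algebra. -/
def Config (d : ℕ) := CadlagPath d × Barrier d

instance (d : ℕ) : TopologicalSpace (Config d) :=
  inferInstanceAs (TopologicalSpace (CadlagPath d × Barrier d))

instance (d : ℕ) : MeasurableSpace (Config d) := borel (Config d)

instance (d : ℕ) : BorelSpace (Config d) := ⟨rfl⟩

/-- The scalarized path `y(t) = Φ(t, x(t))`. -/
def scalarPath {d : ℕ} (x : CadlagPath d) (Φ : Barrier d) (t : ℝ≥0) : ℝ := Φ (t, x t)

/-- The exit time `τ(x, Φ) = inf {t ≥ 0 : y(t) ≥ 0} ∈ [0,∞]`, with `inf ∅ = ∞`. -/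
noncomputable def exitTime {d : ℕ} (x : CadlagPath d) (Φ : Barrier d) : ℝ≥0∞ :=
  sInf ((fun t : ℝ≥0 => (t : ℝ≥0∞)) '' {t | 0 ≤ scalarPath x Φ t})

/-- Non-tangential crossing at level `0`. Suprema are taken in `[-∞,∞]`. Either there is no exit
and `sup_{[0,T]} y < 0` for every `T > 0`; or the exit time is finite, `sup_{[0,T]} y < 0` for
every `T < τ`, and `sup_{[τ,τ+ε]} y > 0` for every `ε > 0`. -/
def SatisfiesNT {d : ℕ} (x : CadlagPath d) (Φ : Barrier d) : Prop :=
  (exitTime x Φ = ∞ ∧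
    ∀ T : ℝ≥0, 0 < T → (⨆ s ∈ Icc 0 T, (scalarPath x Φ s : EReal)) < 0) ∨
  (exitTime x Φ < ∞ ∧
    (∀ T : ℝ≥0, (T : ℝ≥0∞) < exitTime x Φ →
      (⨆ s ∈ Icc 0 T, (scalarPath x Φ s : EReal)) < 0) ∧
    ∀ ε : ℝ≥0, 0 < ε →
      0 < ⨆ s ∈ Icc (exitTime x Φ).toNNReal ((exitTime x Φ).toNNReal + ε),
        (scalarPath x Φ s : EReal))

/-! The exit time is continuous at every NT configuration (`SatisfiesNT.continuousAt_exitTime`).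
Before `τ` the path `y` stays below a negative level, which survives small perturbations, so `τ`
cannot drop much; just after `τ` it is strictly positive somewhere, an open condition, so `τ` cannot
rise much. Weak convergence then follows by the portmanteau theorem for open sets. Measurability of
`τ` up to null sets (`aemeasurable_exitTime`) uses no NT: a maximal measurable minorant `S` of `τ`
must equal `τ` almost everywhere, since wherever `y` stays below some `-δ` right after `S`,
right-continuity would allow `S` to be increased. -/

theorem continuousWithinAt_scalarPath {d : ℕ} (x : CadlagPath d) (Φ : Barrier d)
    (t : ℝ≥0) : ContinuousWithinAt (scalarPath x Φ) (Ici t) t :=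
  Φ.continuous.continuousAt.comp_continuousWithinAt
    (continuousWithinAt_id.prodMk (x.right_cts t))

/-! ### Skorokhod uniformity and boundedness of paths -/

namespace CadlagPath

variable {d : ℕ}

theorem hasBasis_uniformity : (𝓤 (CadlagPath d)).HasBasis
    (fun p : ℝ≥0 × ℝ => 0 < p.2) (fun p => entourage d p.1 p.2) := by
  refine (entourageBasis d).hasBasis.to_hasBasis ?_ ?_
  · rintro _ ⟨T, ε, hε, rfl⟩
    exact ⟨(T, ε), hε, Subset.rfl⟩
  · rintro ⟨T, ε⟩ hε
    exact ⟨_, ⟨T, ε, hε, rfl⟩, Subset.rfl⟩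

theorem entourage_mem_uniformity (T : ℝ≥0) {ε : ℝ} (hε : 0 < ε) :
    entourage d T ε ∈ 𝓤 (CadlagPath d) :=
  hasBasis_uniformity.mem_of_mem (i := (T, ε)) hε

/-- Makes `Config d` pseudometrizable, as the portmanteau theorem requires. -/
instance : (𝓤 (CadlagPath d)).IsCountablyGenerated := by
  have h : (𝓤 (CadlagPath d)).HasBasis (fun _ : ℕ => True)
      (fun n => entourage d n (1 / ((n : ℝ) + 1))) := by
    refine hasBasis_uniformity.to_hasBasis ?_ ?_
    · rintro ⟨T, ε⟩ hε
      obtain ⟨n, hn⟩ := exists_nat_one_div_lt (show (0 : ℝ) < ε from hε)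
      obtain ⟨m, hm⟩ := exists_nat_ge T
      refine ⟨max n m, trivial, entourage_mono (hm.trans (by simp)) (le_trans ?_ hn.le)⟩
      exact one_div_le_one_div_of_le (by positivity) (by simp)
    · intro n _
      exact ⟨(n, 1 / ((n : ℝ) + 1)), by positivity, Subset.rfl⟩
  exact h.isCountablyGenerated

/-- Càdlàg paths are bounded on compact time intervals. -/
theorem isBounded_image_Iic (x : CadlagPath d) (T : ℝ≥0) : Bornology.IsBounded (x '' Iic T) := by
  have hK : IsCompact (Iic T) := Icc_bot (a := T) ▸ isCompact_Icc
  refine hK.induction_on (p := fun s => Bornology.IsBounded (x '' s)) (by simp)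
    (fun s t hst ht => ht.subset (image_mono hst))
    (fun s t hs ht => by simpa [image_union] using ⟨hs, ht⟩) fun t _ => ?_
  have key : ∀ {l : Filter ℝ≥0} {a}, Tendsto x l (𝓝 a) → ∀ᶠ s in l, x s ∈ Metric.ball a 1 :=
    fun h => h (Metric.ball_mem_nhds _ one_pos)
  obtain ⟨a, ha⟩ := x.left_lim t
  refine ⟨{s | x s ∈ Metric.ball a 1 ∪ Metric.ball (x t) 1}, mem_nhdsWithin_of_mem_nhds ?_, ?_⟩
  · rw [← nhdsLT_sup_nhdsGE, mem_sup]
    exact ⟨(key ha).mono fun s hs => Or.inl hs, (key (x.right_cts t)).mono fun s hs => Or.inr hs⟩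
  · refine (Metric.isBounded_ball.union Metric.isBounded_ball :
      Bornology.IsBounded (Metric.ball a 1 ∪ Metric.ball (x t) 1)).subset ?_
    rintro _ ⟨s, hs, rfl⟩
    exact hs

end CadlagPath

open CadlagPath

instance (d : ℕ) : TopologicalSpace.PseudoMetrizableSpace (Config d) :=
  inferInstanceAs (TopologicalSpace.PseudoMetrizableSpace (CadlagPath d × Barrier d))

/-! ### Continuity of the exit time under NT -/

/-- The set of configurations whose scalarized path exceeds the level `c` at some time in a given
open set is open. -/
theorem isOpen_setOf_exists_lt_scalarPath {d : ℕ} {U : Set ℝ≥0} (hU : IsOpen U) (c : ℝ) :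
    IsOpen {p : Config d | ∃ s ∈ U, c < scalarPath p.1 p.2 s} := by
  rw [isOpen_iff_mem_nhds]
  rintro ⟨x, Φ⟩ ⟨s, hs, hc⟩
  have hV : IsOpen (Prod.fst ⁻¹' U ∩ Φ ⁻¹' Ioi c) :=
    (hU.preimage continuous_fst).inter (isOpen_Ioi.preimage Φ.continuous)
  obtain ⟨r, hr, hrV⟩ := Metric.nhds_basis_closedBall.mem_iff.1
    (hV.mem_nhds (show (s, x s) ∈ _ from ⟨hs, hc⟩))
  have hΦ : {Ψ : Barrier d | MapsTo Ψ (Metric.closedBall (s, x s) r) (Ioi c)} ∈ 𝓝 Φ :=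
    (ContinuousMap.isOpen_setOfPred_mapsTo (isCompact_closedBall _ _) isOpen_Ioi).mem_nhds
      fun p hp => (hrV hp).2
  have hx := mem_nhds_right x (entourage_mem_uniformity (d := d) s hr)
  refine mem_of_superset (prod_mem_nhds hx hΦ) ?_
  rintro ⟨x', Ψ⟩ ⟨⟨γ, h1, h2⟩, hΨ⟩
  have hmem : (γ s, x' (γ s)) ∈ Metric.closedBall (s, x s) r := by
    rw [Metric.mem_closedBall, Prod.dist_eq]
    exact max_le (h1 s) (h2 s le_rfl)
  exact ⟨γ s, (hrV hmem).1, hΨ hmem⟩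

/-- If the scalarized path stays below a negative level on `[0, T]`, then the scalarized paths of
nearby configurations are negative on shorter intervals. -/
theorem eventually_scalarPath_neg {d : ℕ} (p : Config d) {a T : ℝ≥0} (haT : a < T) {c : ℝ}
    (hc : c < 0) (h : ∀ s ≤ T, scalarPath p.1 p.2 s ≤ c) :
    ∀ᶠ q : Config d in 𝓝 p, ∀ s ≤ a, scalarPath q.1 q.2 s < 0 := by
  obtain ⟨x, Φ⟩ := p
  set A : Set (ℝ≥0 × EuclideanSpace ℝ (Fin d)) := (fun s => (s, x s)) '' Iic T with hA
  have hAb : Bornology.IsBounded A := by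
    have hI : Bornology.IsBounded (Iic T) := Icc_bot (a := T) ▸ isCompact_Icc.isBounded
    refine (hI.prod (x.isBounded_image_Iic T)).subset ?_
    rintro _ ⟨s, hs, rfl⟩
    exact ⟨hs, s, hs, rfl⟩
  -- The graph over `[0, T]` need not be closed because of jumps; its closure is compact and `Φ ≤ c`
  -- persists there.
  have hK : IsCompact (closure A) := hAb.isCompact_closure
  have hKΦ : closure A ⊆ Φ ⁻¹' Iio 0 := by
    have : closure A ⊆ Φ ⁻¹' Iic c := by
      refine closure_minimal ?_ (isClosed_Iic.preimage Φ.continuous)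
      rintro _ ⟨s, hs, rfl⟩
      exact h s hs
    exact fun z hz => lt_of_le_of_lt (this hz) hc
  obtain ⟨r, hr, hrK⟩ := hK.exists_cthickening_subset_open
    (isOpen_Iio.preimage Φ.continuous) hKΦ
  have hΦ : {Ψ : Barrier d | MapsTo Ψ (Metric.cthickening r (closure A)) (Iio 0)} ∈ 𝓝 Φ :=
    (ContinuousMap.isOpen_setOfPred_mapsTo hK.cthickening isOpen_Iio).mem_nhds hrK
  -- The gap `T - a` is the room for the time change: it keeps `γ s ≤ T` for `s ≤ a`.
  have haT' : (0 : ℝ) < T - a := sub_pos.2 haT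
  have hx := mem_nhds_left x
    (entourage_mem_uniformity (d := d) a (lt_min hr haT'))
  refine mem_of_superset (prod_mem_nhds hx hΦ) ?_
  rintro ⟨x', Ψ⟩ ⟨⟨γ, h1, h2⟩, hΨ⟩ s hs
  have hγ : γ s ≤ T := by
    have : (γ s : ℝ) - s ≤ T - a := (abs_le.1 ((h1 s).trans (min_le_right _ _))).2
    have hs' : (s : ℝ) ≤ a := hs
    exact NNReal.coe_le_coe.1 (by linarith)
  refine hΨ (Metric.mem_cthickening_of_dist_le (s, x' s) (γ s, x (γ s)) r _
    (subset_closure ⟨γ s, hγ, rfl⟩) ?_)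
  rw [Prod.dist_eq, dist_comm, dist_comm (x' s)]
  exact max_le ((h1 s).trans (min_le_left _ _)) ((h2 s hs).trans (min_le_left _ _))

theorem exitTime_le {d : ℕ} {x : CadlagPath d} {Φ : Barrier d} {s : ℝ≥0}
    (h : 0 ≤ scalarPath x Φ s) : exitTime x Φ ≤ s :=
  sInf_le ⟨s, h, rfl⟩

theorem le_exitTime {d : ℕ} {x : CadlagPath d} {Φ : Barrier d} {b : ℝ≥0∞}
    (h : ∀ s : ℝ≥0, 0 ≤ scalarPath x Φ s → b ≤ s) : b ≤ exitTime x Φ := by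
  refine le_sInf ?_
  rintro _ ⟨s, hs, rfl⟩
  exact h s hs

theorem SatisfiesNT.exists_scalarPath_le {d : ℕ} {x : CadlagPath d} {Φ : Barrier d}
    (h : SatisfiesNT x Φ) {T : ℝ≥0} (hT : 0 < T) (hlt : (T : ℝ≥0∞) < exitTime x Φ) :
    ∃ c < 0, ∀ s ≤ T, scalarPath x Φ s ≤ c := by
  have hsup : (⨆ s ∈ Icc 0 T, (scalarPath x Φ s : EReal)) < 0 := by
    rcases h with ⟨-, h⟩ | ⟨-, h, -⟩
    exacts [h T hT, h T hlt]
  obtain ⟨c, hc, hc0⟩ := EReal.lt_iff_exists_real_btwn.1 hsup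
  refine ⟨c, by exact_mod_cast hc0, fun s hs => ?_⟩
  have := (le_iSup₂ (f := fun s (_ : s ∈ Icc 0 T) => (scalarPath x Φ s : EReal)) s
    ⟨zero_le, hs⟩).trans hc.le
  exact_mod_cast this

theorem SatisfiesNT.exists_scalarPath_pos {d : ℕ} {x : CadlagPath d} {Φ : Barrier d}
    (h : SatisfiesNT x Φ) {b : ℝ≥0∞} (hlt : exitTime x Φ < b) :
    ∃ s : ℝ≥0, (s : ℝ≥0∞) < b ∧ 0 < scalarPath x Φ s := by
  rcases h with ⟨h, -⟩ | ⟨hfin, -, h⟩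
  · simp [h] at hlt
  obtain ⟨t, ht⟩ : ∃ t : ℝ≥0, exitTime x Φ = t := ⟨_, (ENNReal.coe_toNNReal hfin.ne).symm⟩
  rw [ht] at hlt h
  obtain ⟨u, htu, hub⟩ := ENNReal.lt_iff_exists_nnreal_btwn.1 hlt
  have htu' : t < u := by exact_mod_cast htu
  have := h (u - t) (tsub_pos_of_lt htu')
  simp only [ENNReal.toNNReal_coe, add_tsub_cancel_of_le htu'.le, lt_iSup_iff] at this
  obtain ⟨s, hs, hpos⟩ := this
  exact ⟨s, lt_of_le_of_lt (by exact_mod_cast hs.2) hub, by exact_mod_cast hpos⟩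

/-- The exit time is continuous at every configuration with non-tangential crossing. -/
theorem SatisfiesNT.continuousAt_exitTime {d : ℕ} {p : Config d} (h : SatisfiesNT p.1 p.2) :
    ContinuousAt (fun q : Config d => exitTime q.1 q.2) p := by
  refine tendsto_order.2 ⟨fun b hb => ?_, fun b hb => ?_⟩
  · obtain ⟨a, hba, ha⟩ := ENNReal.lt_iff_exists_nnreal_btwn.1 hb
    obtain ⟨T, haT, hT⟩ := ENNReal.lt_iff_exists_nnreal_btwn.1 ha
    have haT' : a < T := by exact_mod_cast haT
    obtain ⟨c, hc, hle⟩ := h.exists_scalarPath_le (pos_of_gt haT') hT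
    filter_upwards [eventually_scalarPath_neg p haT' hc hle] with q hq
    refine hba.trans_le (le_exitTime fun s hs => ?_)
    by_contra! hsa
    exact (hq s (by exact_mod_cast hsa.le)).not_ge hs
  · obtain ⟨s, hsb, hs⟩ := h.exists_scalarPath_pos hb
    have hU : IsOpen {s : ℝ≥0 | (s : ℝ≥0∞) < b} :=
      isOpen_lt ENNReal.continuous_coe continuous_const
    filter_upwards [(isOpen_setOf_exists_lt_scalarPath hU 0).mem_nhds
      (show p ∈ _ from ⟨s, hsb, hs⟩)]
    rintro q ⟨t, htb, ht⟩
    exact (exitTime_le ht.le).trans_lt htb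

/-! ### Measurability of the exit time -/

/-- Every function has a measurable minorant that is almost everywhere maximal. -/
theorem exists_measurable_le_forall_ae_eq {α : Type*} [MeasurableSpace α] (μ : Measure α)
    [IsFiniteMeasure μ] (f : α → ℝ≥0∞) :
    ∃ g : α → ℝ≥0∞, Measurable g ∧ g ≤ f ∧
      ∀ h : α → ℝ≥0∞, Measurable h → g ≤ h → h ≤ f → g =ᵐ[μ] h := by
  -- A bounded injective monotone rescaling: integrals become finite, so equal integrals of ordered
  -- functions force a.e. equality.
  set φ : ℝ≥0∞ → ℝ≥0∞ := fun x => 1 - (x + 1)⁻¹ with hφ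
  have hφm : Monotone φ := fun x y hxy => by simp only [hφ]; gcongr
  have hφmeas : Measurable φ := by fun_prop
  have hφ1 : ∀ x, φ x ≤ 1 := fun x => tsub_le_self
  have hle1 : ∀ x : ℝ≥0∞, (x + 1)⁻¹ ≤ 1 := fun x => ENNReal.inv_le_one.2 le_add_self
  have hφinj : Function.Injective φ := fun x y hxy => by
    have := (ENNReal.sub_right_inj ENNReal.one_ne_top (hle1 x) (hle1 y)).1 hxy
    exact (ENNReal.add_left_inj ENNReal.one_ne_top).1 (inv_injective this)
  obtain ⟨k, hk, hkf, hkint⟩ := exists_measurable_le_lintegral_eq (μ := μ) (φ ∘ f)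
  have hk1 : ∀ a, k a ≤ 1 := fun a => (hkf a).trans (hφ1 _)
  -- This is `φ⁻¹ ∘ k`, with `k a = 1` sent to `∞`.
  set g : α → ℝ≥0∞ := fun a => (1 - k a)⁻¹ - 1 with hg
  have hgm : Measurable g := by fun_prop
  have hkg : ∀ a, k a ≤ φ (g a) := fun a => by
    have h1 : (1 - k a)⁻¹ ≤ g a + 1 := le_tsub_add
    have h2 : (g a + 1)⁻¹ ≤ 1 - k a := by
      rw [← inv_inv (1 - k a)]; exact ENNReal.inv_le_inv.2 h1
    calc k a = 1 - (1 - k a) := (ENNReal.sub_sub_cancel ENNReal.one_ne_top (hk1 a)).symm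
      _ ≤ φ (g a) := tsub_le_tsub_left h2 1
  refine ⟨g, hgm, fun a => ?_, fun h hh hgh hhf => ?_⟩
  · refine tsub_le_iff_right.2 ?_
    rw [← inv_inv (f a + 1)]
    refine ENNReal.inv_le_inv.2 ?_
    calc (f a + 1)⁻¹ = 1 - φ (f a) :=
        (ENNReal.sub_sub_cancel ENNReal.one_ne_top (hle1 _)).symm
      _ ≤ 1 - k a := tsub_le_tsub_left (hkf a) 1
  · have hfin : ∫⁻ a, φ (g a) ∂μ ≠ ∞ :=
      ne_top_of_le_ne_top (by simp : ∫⁻ _, 1 ∂μ ≠ ∞) (lintegral_mono fun a => hφ1 _)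
    have hint : ∫⁻ a, φ (h a) ∂μ ≤ ∫⁻ a, φ (g a) ∂μ :=
      calc ∫⁻ a, φ (h a) ∂μ ≤ ∫⁻ a, (φ ∘ f) a ∂μ := lintegral_mono fun a => hφm (hhf a)
        _ = ∫⁻ a, k a ∂μ := hkint
        _ ≤ _ := lintegral_mono hkg
    exact (ae_eq_of_ae_le_of_lintegral_le (ae_of_all _ fun a => hφm (hgh a)) hfin
      (hφmeas.comp hh).aemeasurable hint).mono fun a ha => hφinj ha

/-- A dense time between `S p` and `s` replaces the random left endpoint by countably many fixed
ones, each giving an open set. -/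
theorem measurableSet_setOf_exists_lt_scalarPath {d : ℕ} {S : Config d → ℝ≥0∞}
    (hS : Measurable S) (q : ℝ≥0) (c : ℝ) :
    MeasurableSet {p : Config d | ∃ s : ℝ≥0, S p < s ∧ s < q ∧ c < scalarPath p.1 p.2 s} := by
  have : {p : Config d | ∃ s : ℝ≥0, S p < s ∧ s < q ∧ c < scalarPath p.1 p.2 s} =
      ⋃ n : ℕ, {p | S p < TopologicalSpace.denseSeq ℝ≥0 n} ∩
        {p : Config d | ∃ s ∈ Ioo (TopologicalSpace.denseSeq ℝ≥0 n) q,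
          c < scalarPath p.1 p.2 s} := by
    ext p
    simp only [mem_ofPred_eq, mem_iUnion, mem_inter_iff, mem_Ioo]
    constructor
    · rintro ⟨s, hs, hq, hc⟩
      obtain ⟨u, hu, hus⟩ := ENNReal.lt_iff_exists_nnreal_btwn.1 hs
      obtain ⟨_, ⟨n, rfl⟩, hn, hn'⟩ := (TopologicalSpace.denseRange_denseSeq ℝ≥0).exists_between
        (show u < s by exact_mod_cast hus)
      exact ⟨n, hu.trans (by exact_mod_cast hn), s, ⟨hn', hq⟩, hc⟩
    · rintro ⟨n, hn, s, ⟨hs, hq⟩, hc⟩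
      exact ⟨s, hn.trans (by exact_mod_cast hs), hq, hc⟩
  rw [this]
  exact .iUnion fun n => (measurableSet_lt hS measurable_const).inter
    (isOpen_setOf_exists_lt_scalarPath isOpen_Ioo c).measurableSet

/-- The exit time is measurable with respect to the completion of any finite Borel measure. -/
theorem aemeasurable_exitTime {d : ℕ} (μ : Measure (Config d)) [IsFiniteMeasure μ] :
    AEMeasurable (fun p : Config d => exitTime p.1 p.2) μ := by
  obtain ⟨S, hS, hSle, hmax⟩ :=
    exists_measurable_le_forall_ae_eq μ (fun p : Config d => exitTime p.1 p.2)
  refine ⟨S, hS, ?_⟩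
  set Q := TopologicalSpace.denseSeq ℝ≥0
  set δ : ℕ → ℝ := fun k => 1 / ((k : ℝ) + 1)
  have hδ : ∀ k, 0 < δ k := fun k => by positivity
  have hB : ∀ n k : ℕ, ∀ᵐ p ∂μ, ¬ (S p < Q n ∧
      ¬ ∃ s : ℝ≥0, S p < s ∧ s < Q n ∧ -δ k < scalarPath p.1 p.2 s) := by
    intro n k
    classical
    set B := {p : Config d | S p < Q n ∧
      ¬ ∃ s : ℝ≥0, S p < s ∧ s < Q n ∧ -δ k < scalarPath p.1 p.2 s}
    have hBm : MeasurableSet B := (measurableSet_lt hS measurable_const).inter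
      (measurableSet_setOf_exists_lt_scalarPath hS _ _).compl
    -- Raising `S` to `Q n` on `B` keeps a measurable minorant, so maximality makes `B` null.
    refine (hmax (fun p => if p ∈ B then (Q n : ℝ≥0∞) else S p)
      (Measurable.ite hBm measurable_const hS) (fun p => ?_) (fun p => ?_)).mono
        fun p hp hpB => hpB.1.ne (hp.trans (if_pos (show p ∈ B from hpB)))
    · dsimp only
      split_ifs with hpB
      exacts [hpB.1.le, le_rfl]
    · dsimp only
      split_ifs with hpB
      · refine le_exitTime fun s hs => ?_
        by_contra! hsq
        have hsq' : s < Q n := by exact_mod_cast hsq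
        have hbelow : ∀ u : ℝ≥0, S p < u → u < Q n → scalarPath p.1 p.2 u ≤ -δ k :=
          fun u h1 h2 => not_lt.1 fun h3 => hpB.2 ⟨u, h1, h2, h3⟩
        have hSs : S p ≤ s := (hSle p).trans (exitTime_le hs)
        -- Since `s = S p` is possible, the bound reaches `s` only as a limit from the right.
        have hlim : Tendsto (scalarPath p.1 p.2) (𝓝[>] s) (𝓝 (scalarPath p.1 p.2 s)) :=
          (continuousWithinAt_scalarPath p.1 p.2 s).mono_left
            (nhdsWithin_mono _ Ioi_subset_Ici_self)
        have hle : scalarPath p.1 p.2 s ≤ -δ k := by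
          refine le_of_tendsto hlim ?_
          filter_upwards [Ioo_mem_nhdsGT hsq'] with u hu
          exact hbelow u (hSs.trans_lt (by exact_mod_cast hu.1)) hu.2
        linarith [hδ k]
      · exact hSle p
  filter_upwards [ae_all_iff.2 fun n => ae_all_iff.2 (hB n)] with p hp
  refine (hSle p).antisymm' ?_
  by_contra! hlt
  obtain ⟨t, ht⟩ : ∃ t : ℝ≥0, S p = t := ⟨_, (ENNReal.coe_toNNReal hlt.ne_top).symm⟩
  have hneg : scalarPath p.1 p.2 t < 0 := by
    by_contra! h
    exact (exitTime_le h).not_gt (ht ▸ hlt)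
  obtain ⟨k, hk⟩ := exists_nat_one_div_lt (neg_pos.2 hneg)
  have hev : ∀ᶠ s in 𝓝[≥] t, scalarPath p.1 p.2 s < -δ k :=
    (continuousWithinAt_scalarPath p.1 p.2 t).eventually_lt_const
      (by change 1 / ((k : ℝ) + 1) < _ at hk; change _ < -(1 / ((k : ℝ) + 1)); linarith)
  obtain ⟨u, htu, hu⟩ := mem_nhdsGE_iff_exists_Ico_subset.1 hev
  obtain ⟨_, ⟨n, rfl⟩, hn, hn'⟩ :=
    (TopologicalSpace.denseRange_denseSeq ℝ≥0).exists_between (show t < u from htu)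
  refine hp n k ⟨by rw [ht]; exact_mod_cast hn, ?_⟩
  rintro ⟨s, hs, hsn, hlt'⟩
  rw [ht] at hs
  have hts : t < s := by exact_mod_cast hs
  exact hlt'.not_gt (hu ⟨hts.le, hsn.trans hn'⟩)

/-! ### Weak convergence -/

theorem theorem3p2 {d : ℕ}
    {Ω : ℕ → Type*} [∀ n, MeasurableSpace (Ω n)]
    (P : ∀ n, Measure (Ω n)) [∀ n, IsProbabilityMeasure (P n)]
    {Ω' : Type*} [MeasurableSpace Ω'] (P' : Measure Ω') [IsProbabilityMeasure P']
    (X : ∀ n, Ω n → CadlagPath d) (Φ : ∀ n, Ω n → Barrier d)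
    (X' : Ω' → CadlagPath d) (Φ' : Ω' → Barrier d)
    (hconv : TendstoInDistribution (E := Config d) (fun n ω => (X n ω, Φ n ω)) atTop
      (fun ω => (X' ω, Φ' ω)) P P')
    (hNT : ∀ᵐ ω ∂P', SatisfiesNT (X' ω) (Φ' ω)) :
    TendstoInDistribution (fun n ω => exitTime (X n ω) (Φ n ω)) atTop
      (fun ω => exitTime (X' ω) (Φ' ω)) P P' := by
  obtain ⟨hX, hX', hlim⟩ := hconv
  have := fun n => Measure.isProbabilityMeasure_map (hX n)
  have := Measure.isProbabilityMeasure_map hX'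
  have hτ : ∀ n, AEMeasurable (fun ω => exitTime (X n ω) (Φ n ω)) (P n) := fun n =>
    (aemeasurable_exitTime ((P n).map fun ω => ((X n ω, Φ n ω) : Config d))).comp_aemeasurable
      (hX n)
  have hτ' : AEMeasurable (fun ω => exitTime (X' ω) (Φ' ω)) P' :=
    (aemeasurable_exitTime (P'.map fun ω => ((X' ω, Φ' ω) : Config d))).comp_aemeasurable hX'
  refine ⟨hτ, hτ', tendsto_of_forall_isOpen_le_liminf_nat' fun G hG => ?_⟩
  -- The preimage of `G` need not be open, but by continuity its interior contains all its NT
  -- points, hence almost all of the limit law's mass on it.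
  set V : Set (Config d) := interior {p : Config d | exitTime p.1 p.2 ∈ G} with hV
  have hVo : IsOpen V := isOpen_interior
  have key := ProbabilityMeasure.le_liminf_measure_open_of_tendsto hlim hVo
  simp only [ProbabilityMeasure.coe_mk] at key ⊢
  rw [Measure.map_apply_of_aemeasurable hX' hVo.measurableSet] at key
  rw [Measure.map_apply_of_aemeasurable hτ' hG.measurableSet]
  refine (measure_mono_ae ?_).trans (key.trans (liminf_le_liminf (.of_forall fun n => ?_)))
  · filter_upwards [hNT] with ω hω hωG
    exact mem_interior_iff_mem_nhds.2
      ((SatisfiesNT.continuousAt_exitTime (p := ((X' ω, Φ' ω) : Config d)) hω).preimage_mem_nhds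
        (hG.mem_nhds hωG))
  · rw [Measure.map_apply_of_aemeasurable (hX n) hVo.measurableSet,
      Measure.map_apply_of_aemeasurable (hτ n) hG.measurableSet]
    exact measure_mono (preimage_mono (f := fun ω => ((X n ω, Φ n ω) : Config d)) interior_subset)
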